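/- For a prime $p$ and an abelian group $A$ let $r_p(A)$ denote the dimension of $A[p]=\{a\in A: pa=0\}$ as a vector space over $\mathbb Z/p\mathbb Z$. A cardinal $\theta$ is called compact if it is uncountable and regular and every proper $\theta$-complete filter on any set extends to a $\theta$-complete ultrafilter on that set. Let $\lambda$ be a strong limit cardinal such that some compact cardinal $\theta$ satisfies $\theta<\lambda$, let $G$ be a torsion-free abelian group, and let $p$ be a prime. If $r_p(\operatorname{Ext}(G,\mathbb Z))\ge\lambda$, then $r_p(\operatorname{Ext}(G,\mathbb Z))\ge 2^\lambda$; if moreover $|G|\le\lambda$ (in particular if $|G|=\lambda$), then $r_p(\operatorname{Ext}(G,\mathbb Z))=2^\lambda$. -/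

import Mathlib

universe u

/-- `θ` is a (strongly) compact cardinal: it is uncountable and regular, and every proper
`θ`-complete filter on every set extends to a `θ`-complete ultrafilter on that set.
Here `CardinalInterFilter F θ` says that `F` is closed under intersections of fewer than `θ`
of its members. -/
structure IsCompactCardinal (θ : Cardinal.{u}) : Prop where
  uncountable : Cardinal.aleph0 < θ
  regular : θ.IsRegular
  exists_ultrafilter : ∀ (X : Type u) (F : Filter X), F.NeBot → CardinalInterFilter F θ →
    ∃ U : Ultrafilter X, (U : Filter X) ≤ F ∧ CardinalInterFilter (U : Filter X) θ

/-- The `p`-rank of an abelian group `A`: the dimension of its subgroup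
`A[p] = {a | p • a = 0}` as a vector space over the field `ℤ/pℤ`. -/
noncomputable def pRank (p : ℕ) (A : Type u) [AddCommGroup A] : Cardinal.{u} :=
  letI : Module (ZMod p) (AddSubgroup.torsionBy A (p : ℤ)) :=
    AddSubgroup.torsionBy.zmodModule
  Module.rank (ZMod p) (AddSubgroup.torsionBy A (p : ℤ))

/-- The abelian group `Ext(G, ℤ) = Ext¹(G, ℤ)`, computed in the category of abelian groups
(that is, of `ℤ`-modules) in the universe of `G`. -/
abbrev ExtInt (G : Type u) [AddCommGroup G] : Type u :=
  CategoryTheory.Abelian.Ext (ModuleCat.of ℤ G) (ModuleCat.of ℤ (ULift.{u} ℤ)) 1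

open CategoryTheory Cardinal

/-! The sequence `0 → ℤ → ℤ → ℤ/p → 0` identifies the `p`-torsion of `Ext(G, ℤ)` with `Hom(G, ℤ/p)`
modulo the homomorphisms that lift to `ℤ`. A basis of `G/pG` turns `Hom(G, ℤ/p)` into a power of
`ℤ/p`, and compactness of `θ` makes non-liftability visible on fewer than `θ` coordinates
(`IsCompactCardinal.exists_lift`). A quotient of size at least `λ` then allows a recursion of length
`λ`: each stage picks a nonliftable `f i` that vanishes on all earlier small supports. Gluing along
subsets of `λ` gives `2 ^ λ` distinct classes (`two_power_le_mk_of_local`). The upper bound counts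
maps `G → ℤ/p`. -/

/-- The short complex `0 → ℤ → ℤ → ZMod n → 0`, lifted to the universe `u`. -/
noncomputable abbrev intMulShortComplex (n : ℕ) : ShortComplex (ModuleCat.{u} ℤ) :=
  ShortComplex.mk (X₁ := ModuleCat.of ℤ (ULift.{u} ℤ)) (X₂ := ModuleCat.of ℤ (ULift.{u} ℤ))
    (X₃ := ModuleCat.of ℤ (ULift.{u} (ZMod n)))
    (n • 𝟙 (ModuleCat.of ℤ (ULift.{u} ℤ)))
    (ModuleCat.ofHom (ULift.moduleEquiv.symm.toLinearMap ∘ₗ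
      (Int.castAddHom (ZMod n)).toIntLinearMap ∘ₗ ULift.moduleEquiv.toLinearMap))
    (by ext; simp)

theorem intMulShortComplex_shortExact (n : ℕ) (hn : n ≠ 0) :
    (intMulShortComplex.{u} n).ShortExact := by
  refine ModuleCat.shortComplex_shortExact _ ?_ ?_ ?_
  · rintro ⟨y⟩
    constructor
    · intro h
      have h' : ((y : ℤ) : ZMod n) = 0 := congrArg ULift.down h
      rw [ZMod.intCast_zmod_eq_zero_iff_dvd] at h'
      obtain ⟨c, rfl⟩ := h'
      exact ⟨⟨c⟩, by ext; simp⟩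
    · rintro ⟨⟨c⟩, hc⟩
      have h' : (n : ℤ) * c = y := by simpa using congrArg ULift.down hc
      apply ULift.ext
      show ((y : ℤ) : ZMod n) = 0
      rw [← h']; simp
  · rintro ⟨x⟩ ⟨y⟩ h
    have h' : (n : ℤ) * x = n * y := by simpa using congrArg ULift.down h
    ext
    simpa [hn] using h'
  · rintro ⟨y⟩
    obtain ⟨x, rfl⟩ := ZMod.intCast_surjective y
    exact ⟨⟨x⟩, rfl⟩

/-- The connecting map `Hom(G, ℤ/n) → Ext(G, ℤ)`. -/
noncomputable def extConnecting (G : Type u) [AddCommGroup G] (n : ℕ) (hn : n ≠ 0) :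
    (G →+ ZMod n) →+ ExtInt G where
  toFun f := (Abelian.Ext.mk₀ (ModuleCat.ofHom (X := G) (Y := ULift.{u} (ZMod n))
    (ULift.moduleEquiv.symm.toLinearMap ∘ₗ f.toIntLinearMap))).comp
      (intMulShortComplex_shortExact.{u} n hn).extClass (zero_add 1)
  map_zero' := by
    rw [← Abelian.Ext.zero_comp (n := 0) _ _ _ (zero_add 1)]
    · congr 1
      rw [Abelian.Ext.mk₀_eq_zero_iff]
      ext; rfl
  map_add' f g := by
    rw [← Abelian.Ext.add_comp, ← Abelian.Ext.mk₀_add]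
    congr 2

theorem extConnecting_eq_zero_iff {G : Type u} [AddCommGroup G] {n : ℕ} (hn : n ≠ 0)
    (f : G →+ ZMod n) :
    extConnecting G n hn f = 0 ↔ ∃ ψ : G →+ ℤ, ∀ x, (ψ x : ZMod n) = f x := by
  constructor
  · intro h
    obtain ⟨x₂, hx₂⟩ := Abelian.Ext.covariant_sequence_exact₃ _
      (intMulShortComplex_shortExact.{u} n hn) _ (zero_add 1) h
    obtain ⟨ψ, rfl⟩ := (Abelian.Ext.mk₀_bijective _ _).2 x₂
    rw [Abelian.Ext.mk₀_comp_mk₀] at hx₂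
    have h₂ := (Abelian.Ext.mk₀_bijective _ _).1 hx₂
    refine ⟨(ULift.moduleEquiv.toLinearMap ∘ₗ ψ.hom).toAddMonoidHom, fun x => ?_⟩
    have h₃ := congrArg (fun φ => ULift.down (φ.hom x)) h₂
    exact h₃
  · rintro ⟨ψ, hψ⟩
    have : ModuleCat.ofHom (X := G) (Y := ULift.{u} (ZMod n))
        (ULift.moduleEquiv.symm.toLinearMap ∘ₗ f.toIntLinearMap) =
        ModuleCat.ofHom (X := G) (Y := ULift.{u} ℤ)
          (ULift.moduleEquiv.symm.toLinearMap ∘ₗ ψ.toIntLinearMap) ≫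
          (intMulShortComplex.{u} n).g := by
      ext x
      exact (hψ x).symm
    change (Abelian.Ext.mk₀ _).comp _ (zero_add 1) = 0
    rw [this, ← Abelian.Ext.mk₀_comp_mk₀, Abelian.Ext.comp_assoc_of_second_deg_zero,
      ShortComplex.ShortExact.comp_extClass, Abelian.Ext.comp_zero]

/-- Multiplication by `n` on `ℤ` induces multiplication by `n` on `Ext`, so this is exactness of the
long sequence at `Ext(G, ℤ)`. -/
theorem nsmul_eq_zero_iff_exists_extConnecting {G : Type u} [AddCommGroup G] {n : ℕ} (hn : n ≠ 0)
    (x : ExtInt G) : n • x = 0 ↔ ∃ f, extConnecting G n hn f = x := by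
  have key : x.comp (Abelian.Ext.mk₀ (intMulShortComplex.{u} n).f) (add_zero 1) = n • x := by
    have : Abelian.Ext.mk₀ (intMulShortComplex.{u} n).f =
        n • Abelian.Ext.mk₀ (𝟙 (ModuleCat.of ℤ (ULift.{u} ℤ))) :=
      map_nsmul Abelian.Ext.addEquiv₀.symm n (𝟙 (ModuleCat.of ℤ (ULift.{u} ℤ)))
    rw [this]
    have h2 := map_nsmul (AddMonoidHom.mk' (fun β => x.comp β (add_zero 1))
      (fun a b => Abelian.Ext.comp_add x a b (add_zero 1))) n
      (Abelian.Ext.mk₀ (𝟙 (ModuleCat.of ℤ (ULift.{u} ℤ))))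
    refine h2.trans ?_
    simp
  rw [← key]
  constructor
  · intro h
    obtain ⟨x₃, hx₃⟩ := Abelian.Ext.covariant_sequence_exact₁ _
      (intMulShortComplex_shortExact.{u} n hn) x h (zero_add 1)
    obtain ⟨φ, rfl⟩ := (Abelian.Ext.mk₀_bijective _ _).2 x₃
    refine ⟨(ULift.moduleEquiv.toLinearMap ∘ₗ φ.hom).toAddMonoidHom, ?_⟩
    rw [← hx₃]
    rfl
  · rintro ⟨f, rfl⟩
    change ((Abelian.Ext.mk₀ _).comp _ (zero_add 1)).comp _ (add_zero 1) = 0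
    rw [Abelian.Ext.comp_assoc_of_third_deg_zero, ShortComplex.ShortExact.extClass_comp,
      Abelian.Ext.comp_zero]

/-- In an ultrafilter closed under countable intersections, a map to a countable type is
eventually constant. -/
theorem Ultrafilter.exists_eventually_eq_of_countable {X Y : Type*} [Countable Y]
    (U : Ultrafilter X) [CountableInterFilter (U : Filter X)] (f : X → Y) :
    ∃ y, ∀ᶠ x in (U : Filter X), f x = y := by
  by_contra! h
  obtain ⟨x, hx⟩ := (eventually_countable_forall.2 h).exists
  exact hx _ rfl

/-- The filter of final segments of the sets of cardinality less than a regular cardinal `θ`. -/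
theorem exists_fine_filter {θ : Cardinal.{u}} (hθ : θ.IsRegular) (ι : Type u) :
    ∃ F : Filter {T : Set ι // #T < θ}, F.NeBot ∧ CardinalInterFilter F θ ∧
      ∀ T₀ : Set ι, #T₀ < θ → ∀ᶠ T in F, T₀ ⊆ T.1 := by
  let F : Filter {T : Set ι // #T < θ} :=
    { sets := {A | ∃ T₀ : Set ι, #T₀ < θ ∧ ∀ T : {T : Set ι // #T < θ}, T₀ ⊆ T.1 → T ∈ A}
      univ_sets := ⟨∅, by simpa using hθ.pos, by simp⟩
      sets_of_superset := fun ⟨T₀, h, h'⟩ hAB => ⟨T₀, h, fun T hT => hAB (h' T hT)⟩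
      inter_sets := by
        rintro A B ⟨T₀, h, h'⟩ ⟨T₁, k, k'⟩
        refine ⟨T₀ ∪ T₁, (mk_union_le _ _).trans_lt (add_lt_of_lt hθ.aleph0_le h k),
          fun T hT => ⟨h' T (Set.subset_union_left.trans hT), k' T (Set.subset_union_right.trans hT)⟩⟩ }
  refine ⟨F, ⟨fun h => ?_⟩, ⟨fun S hS h => ?_⟩, fun T₀ h => ⟨T₀, h, fun T hT => hT⟩⟩
  · obtain ⟨T₀, h₀, h₁⟩ : (∅ : Set {T : Set ι // #T < θ}) ∈ F := h ▸ Filter.mem_bot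
    exact h₁ ⟨T₀, h₀⟩ subset_rfl
  · choose T hT hT' using fun s : S => h s.1 s.2
    refine ⟨⋃ s, T s, (card_iUnion_lt_iff_forall_of_isRegular hθ hS).2 hT, fun T' hT'' => ?_⟩
    exact Set.mem_sInter.2 fun s hs => hT' ⟨s, hs⟩ T' ((Set.subset_iUnion T ⟨s, hs⟩).trans hT'')

/-- If each restriction of `f` to a set of coordinates of cardinality less than a compact cardinal
is the restriction of some `g` whose homomorphism lifts to `ℤ`, then so does `f`. -/
theorem IsCompactCardinal.exists_lift {θ : Cardinal.{u}} (hθ : IsCompactCardinal θ)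
    {ι G : Type u} [AddCommGroup G] {A : Type*} (c : ℤ → A) (e : (ι → A) → G → A)
    (he : ∀ x, ∃ T : Finset ι, ∀ f g : ι → A, (∀ i ∈ T, f i = g i) → e f x = e g x) (f : ι → A)
    (h : ∀ T : Set ι, #T < θ → ∃ g : ι → A, (∀ i ∈ T, g i = f i) ∧
      ∃ ψ : G →+ ℤ, ∀ x, c (ψ x) = e g x) :
    ∃ ψ : G →+ ℤ, ∀ x, c (ψ x) = e f x := by
  obtain ⟨F, hF, hF', hfine⟩ := exists_fine_filter hθ.regular ι
  obtain ⟨U, hU, hU'⟩ := hθ.exists_ultrafilter _ F hF hF'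
  have := CardinalInterFilter.toCountableInterFilter (U : Filter {T : Set ι // #T < θ})
    hθ.uncountable
  choose g hg ψ hψ using fun T : {T : Set ι // #T < θ} => h T.1 T.2
  -- `φ x` is the `U`-limit of the values `ψ T x`; it exists because `ℤ` is countable.
  choose φ hφ using fun x => U.exists_eventually_eq_of_countable fun T => ψ T x
  refine ⟨AddMonoidHom.mk' φ fun x y => ?_, fun x => ?_⟩
  · obtain ⟨T, hx, hy, hxy⟩ := ((hφ x).and ((hφ y).and (hφ (x + y)))).exists
    rw [← hx, ← hy, ← hxy, map_add]
  · obtain ⟨T₀, hT₀⟩ := he x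
    have hfin : ∀ᶠ T in (U : Filter {T : Set ι // #T < θ}), (T₀ : Set ι) ⊆ T.1 :=
      hU (hfine _ ((lt_aleph0_of_finite _).trans hθ.uncountable))
    obtain ⟨T, hx, hT⟩ := ((hφ x).and hfin).exists
    rw [AddMonoidHom.mk'_apply, ← hx, hψ]
    exact hT₀ _ _ fun i hi => hg T i (hT hi)

/-- If `Φ` is a homomorphism from a product of copies of `A` whose kernel is closed in the
`< θ`-box topology, then its range cannot have cardinality in `[λ, 2 ^ λ)` for a strong limit
cardinal `λ` above `θ` and `#A`. -/
theorem two_power_le_mk_of_local {lam θ : Cardinal.{u}} (hlam : lam.IsStrongLimit)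
    (hlam₀ : ℵ₀ < lam) (hθlam : θ < lam) {ι A Q : Type u} [AddCommGroup A] [AddCommGroup Q]
    (hA : #A < lam) (Φ : (ι → A) →+ Q) (hΦ : Function.Surjective Φ)
    (hloc : ∀ f, Φ f ≠ 0 → ∃ T : Set ι, #T < θ ∧ ∀ g : ι → A, (∀ i ∈ T, g i = f i) → Φ g ≠ 0)
    (hQ : lam ≤ #Q) : 2 ^ lam ≤ #Q := by
  classical
  -- The bound by `θ` holds for every `B`, with a junk value for large `B`: the recursion below
  -- needs it to show that its own sets `B i` are small.
  have step : ∀ B : Set ι, ∃ q : (ι → A) × Set ι, #q.2 ≤ θ ∧ (#B < lam →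
      (∀ b ∈ B, q.1 b = 0) ∧ ∀ g : ι → A, (∀ i ∈ q.2, g i = q.1 i) → Φ g ≠ 0) := by
    intro B
    by_cases hB : #B < lam
    swap
    · exact ⟨(0, ∅), by simp, fun h => absurd h hB⟩
    -- Otherwise `Φ f` depends only on the restriction of `f` to `B`, leaving fewer than `λ` values.
    obtain ⟨f, hf, hf'⟩ : ∃ f : ι → A, (∀ b ∈ B, f b = 0) ∧ Φ f ≠ 0 := by
      by_contra! hcon
      have hinj : Function.Injective fun (x : Q) (b : B) => (hΦ x).choose b := by
        intro x y hxy
        have := hcon ((hΦ x).choose - (hΦ y).choose) fun b hb => by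
          simpa [sub_eq_zero] using congrFun hxy ⟨b, hb⟩
        rwa [map_sub, (hΦ x).choose_spec, (hΦ y).choose_spec, sub_eq_zero] at this
      refine absurd (hQ.trans (mk_le_of_injective hinj)) (not_le.2 ?_)
      have hm : max #B (max #A ℵ₀) < lam := max_lt hB (max_lt hA hlam₀)
      calc #(B → A) = #A ^ #B := by simp
        _ ≤ (2 ^ #A) ^ #B := power_le_power_right (cantor _).le
        _ = 2 ^ (#A * #B) := (power_mul).symm
        _ ≤ 2 ^ (max #B (max #A ℵ₀)) := power_le_power_left two_ne_zero (mul_le_of_le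
            (le_max_of_le_right (le_max_right _ _)) (le_max_of_le_right (le_max_left _ _))
            (le_max_left _ _))
        _ < lam := hlam.isStrongPrelimit hm
    obtain ⟨T, hT, hT'⟩ := hloc f hf'
    exact ⟨(f, T), hT.le, fun _ => ⟨hf, hT'⟩⟩
  choose q hq hq' using step
  let I := lam.ord.ToType
  let T : I → Set ι := (wellFounded_lt (α := I)).fix fun i ih => (q (⋃ j : Set.Iio i, ih j.1 j.2)).2
  let B : I → Set ι := fun i => ⋃ j : Set.Iio i, T j
  have hT : ∀ i, T i = (q (B i)).2 := fun i => WellFounded.fix_eq _ _ i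
  let f : I → ι → A := fun i => (q (B i)).1
  have hB : ∀ i, #(B i) < lam := by
    intro i
    refine (mk_iUnion_le _).trans_lt (mul_lt_of_lt hlam.aleph0_le 
      ((mk_Iio_lt i (by simp [I])).trans_eq (mk_ord_toType lam)) ?_)
    refine lt_of_le_of_lt (ciSup_le' fun j => ?_) hθlam
    rw [hT]
    exact hq _
  have hf₀ : ∀ i, ∀ b ∈ B i, f i b = 0 := fun i => (hq' _ (hB i)).1
  have hf₁ : ∀ i, ∀ g : ι → A, (∀ b ∈ T i, g b = f i b) → Φ g ≠ 0 := fun i g hg =>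
    (hq' _ (hB i)).2 g (by rwa [← hT])
  have hmin : ∀ b, (∃ i, b ∈ T i) → ∃ i, b ∈ T i ∧ ∀ j < i, b ∉ T j := by
    intro b hb
    obtain ⟨i, hi, hi'⟩ := (wellFounded_lt (α := I)).has_min {i | b ∈ T i} hb
    exact ⟨i, hi, fun j hj hj' => hi' j hj' hj⟩
  -- At `b`, only the least `i` with `b ∈ T i` decides the value.
  let F : Set I → ι → A := fun S b =>
    if h : ∃ i, b ∈ T i then (if (hmin b h).choose ∈ S then f (hmin b h).choose b else 0) else 0
  have hF : ∀ S b i, b ∈ T i → (∀ j < i, b ∉ T j) → F S b = if i ∈ S then f i b else 0 := by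
    intro S b i hi hi'
    have h : ∃ i, b ∈ T i := ⟨i, hi⟩
    have hi₀ : (hmin b h).choose = i := by
      obtain ⟨h₁, h₂⟩ := (hmin b h).choose_spec
      exact le_antisymm (not_lt.1 fun hlt => h₂ i hlt hi) (not_lt.1 fun hlt => hi' _ hlt h₁)
    simp only [F, dif_pos h, hi₀]
  have hdiff : ∀ S S' : Set I, ∀ i ∈ S, i ∉ S' → (∀ j < i, j ∈ S ↔ j ∈ S') →
      Φ (F S) ≠ Φ (F S') := by
    intro S S' i hi hi' hlt heq
    -- At the first difference `i`, the two glued functions differ by exactly `f i` on `T i`: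
    -- coordinates met earlier cancel, and `f i` vanishes there.
    refine hf₁ i (F S - F S') (fun b hb => ?_) (by rw [map_sub, heq, sub_self])
    obtain ⟨j, hj, hj'⟩ := hmin b ⟨i, hb⟩
    rw [Pi.sub_apply, hF S b j hj hj', hF S' b j hj hj']
    rcases (not_lt.1 fun h => hj' i h hb : j ≤ i).eq_or_lt with rfl | hji
    · simp [hi, hi']
    · rw [hf₀ i b (Set.mem_iUnion.2 ⟨⟨j, hji⟩, hj⟩)]
      simp [hlt j hji]
  have hinj : Function.Injective fun S : Set I => Φ (F S) := by
    intro S S' heq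
    by_contra hne
    obtain ⟨i, hi, hi'⟩ := (wellFounded_lt (α := I)).has_min {i | ¬(i ∈ S ↔ i ∈ S')}
      (by_contra fun h => hne (Set.ext fun i => by_contra fun hi => h ⟨i, hi⟩))
    have hlt : ∀ j < i, j ∈ S ↔ j ∈ S' := fun j hj => by_contra fun h => hi' j h hj
    by_cases hS : i ∈ S
    · exact hdiff S S' i hS (fun h => hi ⟨fun _ => h, fun _ => hS⟩) hlt heq
    · exact hdiff S' S i (by_contra fun h => hi ⟨fun k => absurd k hS, fun k => absurd k h⟩) hS
        (fun j hj => (hlt j hj).symm) heq.symm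
  calc 2 ^ lam = #(Set I) := by rw [mk_set, mk_ord_toType]
    _ ≤ #Q := mk_le_of_injective hinj

/-- An infinite `p`-rank is the cardinality of the `p`-torsion subgroup. -/
theorem mk_torsionBy_eq_pRank {p : ℕ} (hp : p.Prime) {A : Type u} [AddCommGroup A]
    (h : ℵ₀ ≤ pRank p A) : #(AddSubgroup.torsionBy A (p : ℤ)) = pRank p A := by
  have := Fact.mk hp
  let _ : Module (ZMod p) (AddSubgroup.torsionBy A (p : ℤ)) := AddSubgroup.torsionBy.zmodModule
  have e := (Module.Free.chooseBasis (ZMod p) (AddSubgroup.torsionBy A (p : ℤ))).repr.toEquiv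
  have hI : #(Module.Free.ChooseBasisIndex (ZMod p) (AddSubgroup.torsionBy A (p : ℤ))) =
      pRank p A := (Module.Free.rank_eq_card_chooseBasisIndex _ _).symm
  have : Infinite (Module.Free.ChooseBasisIndex (ZMod p) (AddSubgroup.torsionBy A (p : ℤ))) :=
    infinite_iff.2 (hI ▸ h)
  rw [mk_congr e, mk_finsupp_lift_of_infinite, lift_uzero, hI]
  exact max_eq_left ((lift_lt_aleph0.2 (lt_aleph0_of_finite (ZMod p))).le.trans h)

/-- Homomorphisms `G → ℤ/p` have coordinates with respect to a basis of `G/pG`. -/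
theorem exists_coordinates (G : Type u) [AddCommGroup G] (p : ℕ) [Fact p.Prime] :
    ∃ (ι : Type u) (e : (ι → ZMod p) →+ (G →+ ZMod p)), Function.Surjective e ∧
      ∀ x, ∃ T : Finset ι, ∀ f g : ι → ZMod p, (∀ i ∈ T, f i = g i) → e f x = e g x := by
  let b := Module.Basis.ofVectorSpace (ZMod p) (ModN G p)
  let e : (Module.Basis.ofVectorSpaceIndex (ZMod p) (ModN G p) → ZMod p) →+ (G →+ ZMod p) :=
    AddMonoidHom.mk' (fun f => ((b.constr ℕ f : ModN G p →ₗ[ZMod p] ZMod p) :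
      ModN G p →+ ZMod p).comp (ModN.mkQ p))
      fun f g => by ext x; simp [map_add]
  refine ⟨_, e, fun h => ?_, fun x => ⟨(b.repr (ModN.mkQ p x)).support, fun f g hfg => ?_⟩⟩
  · let φ := (ModN.liftEquiv' (n := p) (H := ZMod p)).symm ⟨h, fun x => by simp⟩
    refine ⟨fun i => φ (b i), ?_⟩
    have h₁ : b.constr ℕ (fun i => φ (b i)) = φ := b.constr_self ℕ φ
    ext x
    change (b.constr ℕ (fun i => φ (b i))) (ModN.mkQ p x) = h x
    rw [h₁]
    rfl
  · change b.constr ℕ f (ModN.mkQ p x) = b.constr ℕ g (ModN.mkQ p x)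
    rw [b.constr_apply, b.constr_apply]
    exact Finsupp.sum_congr fun i hi => by rw [hfg i hi]

theorem mainTheorem12 (lam θ : Cardinal.{u}) (hlam : lam.IsStrongLimit)
    (hθ : IsCompactCardinal θ) (hθlam : θ < lam)
    (G : Type u) [AddCommGroup G] [IsAddTorsionFree G]
    (p : ℕ) (hp : p.Prime) (hr : lam ≤ pRank p (ExtInt G)) :
    2 ^ lam ≤ pRank p (ExtInt G) ∧
      (Cardinal.mk G ≤ lam → pRank p (ExtInt G) = 2 ^ lam) := by
  have := Fact.mk hp
  have hlam₀ : ℵ₀ < lam := hθ.uncountable.trans hθlam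
  obtain ⟨ι, e, he, hfin⟩ := exists_coordinates G p
  let δ := extConnecting G p hp.ne_zero
  have hrank := mk_torsionBy_eq_pRank hp (hlam₀.le.trans hr)
  rw [← hrank] at hr ⊢
  let Δ : (G →+ ZMod p) →+ AddSubgroup.torsionBy (ExtInt G) (p : ℤ) :=
    δ.codRestrict _ fun f => AddSubgroup.torsionBy.nsmul_iff.2
      ((nsmul_eq_zero_iff_exists_extConnecting hp.ne_zero _).2 ⟨f, rfl⟩)
  have hΔ : Function.Surjective Δ := by
    rintro ⟨x, hx⟩
    obtain ⟨f, hf⟩ := (nsmul_eq_zero_iff_exists_extConnecting hp.ne_zero x).1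
      (AddSubgroup.torsionBy.nsmul_iff.1 hx)
    exact ⟨f, Subtype.ext hf⟩
  have hΔ₀ : ∀ f, Δ f = 0 ↔ ∃ ψ : G →+ ℤ, ∀ x, (ψ x : ZMod p) = f x := fun f =>
    Subtype.ext_iff.trans (extConnecting_eq_zero_iff hp.ne_zero f)
  have lower : 2 ^ lam ≤ #(AddSubgroup.torsionBy (ExtInt G) (p : ℤ)) := by
    let down : (ι → ULift.{u} (ZMod p)) →+ (ι → ZMod p) :=
      AddMonoidHom.mk' (fun f i => (f i).down) fun f g => rfl
    refine two_power_le_mk_of_local hlam hlam₀ hθlam (A := ULift.{u} (ZMod p))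
      ((lt_aleph0_of_finite _).trans hlam₀) (Δ.comp (e.comp down))
      (hΔ.comp (he.comp fun f => ⟨fun i => ⟨f i⟩, rfl⟩)) (fun f hf => ?_) hr
    -- Locality is the contrapositive of the compactness lemma.
    by_contra! hcon
    refine hf ((hΔ₀ _).2 (hθ.exists_lift (fun m : ℤ => (m : ZMod p)) (fun f => e f) hfin (down f)
      fun T hT => ?_))
    obtain ⟨g, hg, hg'⟩ := hcon T hT
    exact ⟨down g, fun i hi => congrArg ULift.down (hg i hi), (hΔ₀ _).1 hg'⟩
  refine ⟨lower, fun hG => le_antisymm ?_ lower⟩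
  have hc : #(ULift.{u} (ZMod p)) ≤ lam := (lt_aleph0_of_finite _).le.trans hlam₀.le
  calc #(AddSubgroup.torsionBy (ExtInt G) (p : ℤ)) ≤ #(G →+ ZMod p) := mk_le_of_surjective hΔ
    _ ≤ #(G → ULift.{u} (ZMod p)) := mk_le_of_injective (f := fun f x => ⟨f x⟩) fun f g h =>
        DFunLike.ext _ _ fun x => congrArg ULift.down (congrFun h x)
    _ = #(ULift.{u} (ZMod p)) ^ #G := by simp
    _ ≤ lam ^ lam := (power_le_power_right hc).trans
        (power_le_power_left hlam.ne_zero hG)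
    _ = 2 ^ lam := power_self_eq hlam₀.le
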